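/- Let $\mu$ be the standard Gaussian distribution on $\mathbb{R}$, and for a probability distribution $\theta$ on $\mathbb{R}$ put $\chi_2(\theta,\mu)=\bigl(\int (\frac{d\theta}{d\mu}-1)^2\,d\mu\bigr)^{1/2}$ if $\theta\ll\mu$ and $\chi_2(\theta,\mu)=+\infty$ otherwise; for a density $f$ with respect to $\mu$ write $\chi_2(f)=\chi_2(f\cdot\mu,\mu)$. Let $H_k(x)=(-1)^k e^{x^2/2}\frac{d^k}{dx^k}e^{-x^2/2}$ be the Hermite polynomials. Let $r\ge 2$ be an integer and $K=r+1$. Let $\phi$ be a polynomial which is a probability density with respect to $\mu$ (that is, $\phi\ge 0$ on $\mathbb{R}$ and $\int\phi\,d\mu=1$) and whose moments match those of $\mu$ up to order $r$: $\int x^k\phi\,d\mu=\int x^k\,d\mu$ for $1\le k\le r$. Let $N=\deg\phi$ (so either $\phi=1$ and $N=0$, or $N\ge K$), and for $k\ge 0$ set $$\phi_k=\int \phi\,\frac{H_k}{\sqrt{k!}}\,d\mu,\qquad \gamma_k=\frac{1}{\sqrt{k!}}\Bigl(1+\frac NK\Bigr)^{k/2}|\phi_k| .$$ Say that $\phi$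 satisfies Hypothesis (H) (for $r$) if (H1) $(k+2)\gamma_{k+2}\le\gamma_k$ for all integers $k$ with $K\le k\le N-2$; (H2a) if $K\le N-1$, then $$\max\left\{\Bigl(\frac{2(K+1)\gamma_{K+1}}{N}\Bigr)^{N}\Bigl(\frac{K-1}{2\gamma_N}\Bigr)^{K-1},\ \Bigl(\frac{2K\gamma_K}{N-1}\Bigr)^{N-1}\Bigl(\frac{K-2}{2\gamma_{N-1}}\Bigr)^{K-2}\right\}\le\frac{1}{(N-K+1)^{N-K+1}},$$ evaluated in $[0,\infty]$, where a positive number divided by $0$ is $\infty$ and $0\cdot\infty=0$; (H2b) if $K=N$, then $\gamma_N\le\dfrac{1}{2(N-2)^{(N-2)/2}}$. (For $\phi=1$ these conditions are void.) **(i)** Let $(X_i)_{i\ge1}$ be i.i.d. real random variables with density $\phi$ with respect to $\mu$, where $\phi$ is as above and satisfies (H). Then $Y_n=n^{-1/2}\sum_{i=1}^n X_i$ has a density $f_n$ with respect to $\mu$ for every $n\ge1$, and $$\limsup_{n\to\infty}\ n^{\frac{r-1}{2}}\,\chi_2(f_n)<+\infty .$$ **(ii)** The same conclusion holds if the $(X_i)_{i\ge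 1}$ are independent, not necessarily identically distributed, and each $X_i$ has a density with respect to $\mu$ belonging to a fixed finite set of polynomial probability densities, each of which has moments matching those of $\mu$ up to order $r$ and satisfies (H) for this same $r$. -/

import Mathlib

open MeasureTheory ProbabilityTheory Filter
open scoped ENNReal

noncomputable section

/-- The `χ₂`-distance between two measures on the real line: the `L²(μ)`-norm of `dθ/dμ - 1`
if `θ ≪ μ`, and `+∞` otherwise. -/
def chiTwo (θ μ : Measure ℝ) : ℝ≥0∞ :=
  open Classical in
  if θ ≪ μ then
    (∫⁻ x, ENNReal.ofReal (((θ.rnDeriv μ x).toReal - 1) ^ 2) ∂μ) ^ (1 / 2 : ℝ)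
  else ∞

/-- The standard Gaussian measure on the real line. -/
def stdGauss : Measure ℝ := gaussianReal 0 1

/-- The measure with (polynomial) density `φ` with respect to the standard Gaussian measure. -/
def polyLaw (φ : Polynomial ℝ) : Measure ℝ :=
  stdGauss.withDensity fun x => ENNReal.ofReal (φ.eval x)

/-- `φ` is a probability density with respect to the standard Gaussian measure. -/
def IsGaussDensity (φ : Polynomial ℝ) : Prop :=
  (∀ x : ℝ, 0 ≤ φ.eval x) ∧ ∫ x, φ.eval x ∂stdGauss = 1

/-- The moments of the law with density `φ` agree with the Gaussian ones up to order `r`. -/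
def MomentsMatch (r : ℕ) (φ : Polynomial ℝ) : Prop :=
  ∀ k ∈ Finset.Icc 1 r, ∫ x, x ^ k * φ.eval x ∂stdGauss = ∫ x, x ^ k ∂stdGauss

/-- The coefficient `φ_k` of `φ` on the `k`-th normalized (probabilists') Hermite polynomial
`H_k / √(k!)`, in the orthonormal Hermite basis of `L²` of the standard Gaussian measure. -/
def hermiteCoeff (φ : Polynomial ℝ) (k : ℕ) : ℝ :=
  ∫ x, φ.eval x * (Polynomial.aeval x (Polynomial.hermite k) / √(k.factorial : ℝ)) ∂stdGauss

/-- `γ_k = C_k |φ_k| / √(k!)` with `C_k = (1 + N / K) ^ (k / 2)`,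
where `K = r + 1` and `N` is the degree of `φ`. -/
def gammaCoeff (r : ℕ) (φ : Polynomial ℝ) (k : ℕ) : ℝ :=
  (1 + (φ.natDegree : ℝ) / ((r + 1 : ℕ) : ℝ)) ^ ((k : ℝ) / 2) * |hermiteCoeff φ k|
    / √(k.factorial : ℝ)

/-- Hypothesis (H1) for the coefficients `γ` and the integers `K`, `N`. -/
def HypH1 (γ : ℕ → ℝ) (K N : ℕ) : Prop :=
  ∀ k : ℕ, K ≤ k → k + 2 ≤ N → ((k : ℝ) + 2) * γ (k + 2) ≤ γ k

/-- Hypothesis (H2a). It is read in `[0, ∞]`, so that a positive number divided by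
a vanishing `γ` is `∞`, and `0 * ∞ = 0`. -/
def HypH2a (γ : ℕ → ℝ) (K N : ℕ) : Prop :=
  K + 1 ≤ N →
    max
      ((2 * ((K + 1 : ℕ) : ℝ≥0∞) * ENNReal.ofReal (γ (K + 1)) / (N : ℝ≥0∞)) ^ N
        * (((K - 1 : ℕ) : ℝ≥0∞) / (2 * ENNReal.ofReal (γ N))) ^ (K - 1))
      ((2 * (K : ℝ≥0∞) * ENNReal.ofReal (γ K) / ((N - 1 : ℕ) : ℝ≥0∞)) ^ (N - 1)
        * (((K - 2 : ℕ) : ℝ≥0∞) / (2 * ENNReal.ofReal (γ (N - 1)))) ^ (K - 2))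
    ≤ 1 / ((N - K + 1 : ℕ) : ℝ≥0∞) ^ (N - K + 1)

/-- Hypothesis (H2b). -/
def HypH2b (γ : ℕ → ℝ) (K N : ℕ) : Prop :=
  K = N → γ N ≤ 1 / (2 * ((N : ℝ) - 2) ^ (((N : ℝ) - 2) / 2))

/-- Hypothesis (H) on a polynomial density `φ` whose moments match the Gaussian ones up to
order `r`; here `K = r + 1` and `N` is the degree of `φ`. For `φ = 1` one has `N = 0`, and the
hypothesis is void. -/
def HypH (r : ℕ) (φ : Polynomial ℝ) : Prop :=
  HypH1 (gammaCoeff r φ) (r + 1) φ.natDegree ∧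
  HypH2a (gammaCoeff r φ) (r + 1) φ.natDegree ∧
  HypH2b (gammaCoeff r φ) (r + 1) φ.natDegree

/-- The renormalized sum `Y_n = n^{-1/2} (X_0 + ⋯ + X_{n-1})`. -/
def renormSum {Ω : Type*} (X : ℕ → Ω → ℝ) (n : ℕ) (ω : Ω) : ℝ :=
  (∑ i ∈ Finset.range n, X i ω) / √(n : ℝ)

end

/-! Write a polynomial density as `∑ c_k H_k` and let `c = ∑ c_k t^k`, so that `c_k = φ_k / √(k!)`.
The moment generating function of its law is `exp (t²/2) c(t)`. Independence multiplies these
functions, hence `Y_n` has the coefficient polynomial `D(t) = ∏ c_i (t/√n)`, and Parseval gives `χ₂²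
= ∑_{k ≥ 1} k! D_k²` (`chiTwo_stdGauss_of_mgf`).

Replace all coefficients by their absolute values and let `B` be the resulting product before
rescaling. Since `k! = ∫ x^k exp (-x)` over `x > 0`, and a sum of squares of nonnegative numbers is
at most the square of their sum, `χ₂² ≤ ∫ (B(√(x/n)) - 1)² exp (-x)` (`sum_factorial_mul_sq_le`).

Hypothesis (H) says that `q = 1 + ∑ γ_k v^k` satisfies `q' ≤ v q`, so `q ≤ exp (v²/2)`; after
rescaling, each factor of `B` is at most `exp (t²/4)` (`eval_absCoeff_le_exp`). Matching moments
leave only powers `t^k` with `k ≥ K = r + 1` in a factor minus 1, so this difference is at most `A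
t^K exp (t²/4)`. Telescoping yields `B - 1 ≤ n A t^K exp (n t²/4)`. With `t² = x/n` the integrand is
at most `n² A² (x/n)^K exp (-x/2)`, whence `χ₂² = O(n^(2-K)) = O(n^(1-r))`. -/

instance : IsProbabilityMeasure stdGauss := by unfold stdGauss; infer_instance

/-! ### Gaussian integrals of exponentials times polynomials -/

theorem integrable_exp_mul_polynomial_stdGauss (t : ℝ) (p : Polynomial ℝ) :
    Integrable (fun x => Real.exp (t * x) * p.eval x) stdGauss := by
  induction p using Polynomial.induction_on' with
  | add p q hp hq =>
    refine (hp.add hq).congr (ae_of_all _ fun x => ?_)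
    simp [mul_add]
  | monomial n a =>
    have h : t ∈ interior (integrableExpSet id stdGauss) := by
      rw [stdGauss, integrableExpSet_id_gaussianReal]; simp
    refine ((integrable_pow_mul_exp_of_mem_interior_integrableExpSet h n).const_mul a).congr
      (ae_of_all _ fun x => ?_)
    simp; ring

theorem integrable_polynomial_stdGauss (p : Polynomial ℝ) :
    Integrable (fun x => p.eval x) stdGauss := by
  simpa using integrable_exp_mul_polynomial_stdGauss 0 p

theorem integral_stdGauss (f : ℝ → ℝ) :
    ∫ x, f x ∂stdGauss = ∫ x, gaussianPDFReal 0 1 x * f x := by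
  rw [stdGauss, integral_gaussianReal_eq_integral_smul one_ne_zero]; simp

theorem integrable_stdGauss_iff (f : ℝ → ℝ) :
    Integrable f stdGauss ↔ Integrable (fun x => gaussianPDFReal 0 1 x * f x) := by
  rw [stdGauss, gaussianReal_of_var_ne_zero _ one_ne_zero,
    integrable_withDensity_iff_integrable_smul' (measurable_gaussianPDF _ _)
      (ae_of_all _ fun _ => gaussianPDF_lt_top)]
  simp [toReal_gaussianPDF]

theorem hasDerivAt_gaussianPDFReal_zero_one (x : ℝ) :
    HasDerivAt (gaussianPDFReal 0 1) (-x * gaussianPDFReal 0 1 x) x := by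
  have h : HasDerivAt (fun x : ℝ => -x ^ 2 / 2) (-x) x := by
    have := ((hasDerivAt_pow 2 x).neg).div_const 2
    convert! this using 1
    push_cast; ring
  have := (h.exp).const_mul (√(2 * Real.pi))⁻¹
  convert! this using 1
  · ext y; simp [gaussianPDFReal]
  · simp [gaussianPDFReal]; ring

open Polynomial in
/-- Gaussian integration by parts against an exponential. -/
theorem integral_exp_mul_X_mul_sub_derivative (t : ℝ) (p : Polynomial ℝ) :
    ∫ x, Real.exp (t * x) * (X * p - derivative p).eval x ∂stdGauss
      = t * ∫ x, Real.exp (t * x) * p.eval x ∂stdGauss := by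
  have hderiv (x : ℝ) : HasDerivAt
      (fun x => gaussianPDFReal 0 1 x * (Real.exp (t * x) * p.eval x))
      (gaussianPDFReal 0 1 x * (Real.exp (t * x) *
        (C t * p - (X * p - derivative p)).eval x)) x := by
    have h1 : HasDerivAt (fun x => Real.exp (t * x)) (Real.exp (t * x) * t) x := by
      simpa using ((hasDerivAt_id x).const_mul t).exp
    have := (hasDerivAt_gaussianPDFReal_zero_one x).mul (h1.mul (p.hasDerivAt x))
    convert! this using 1
    simp; ring
  have h0 := integral_eq_zero_of_hasDerivAt_of_integrable hderiv
    ((integrable_stdGauss_iff _).1 (integrable_exp_mul_polynomial_stdGauss t _))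
    ((integrable_stdGauss_iff _).1 (integrable_exp_mul_polynomial_stdGauss t p))
  rw [← integral_stdGauss] at h0
  have h2 : ∀ x, Real.exp (t * x) * (C t * p - (X * p - derivative p)).eval x
      = t * (Real.exp (t * x) * p.eval x)
        - Real.exp (t * x) * (X * p - derivative p).eval x := fun x => by
    rw [eval_sub, eval_mul, eval_C]; ring
  simp_rw [h2] at h0
  rw [integral_sub ((integrable_exp_mul_polynomial_stdGauss t p).const_mul t)
    (integrable_exp_mul_polynomial_stdGauss t _), integral_const_mul] at h0
  linarith

/-- The probabilists' Hermite polynomials with real coefficients. -/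
noncomputable def hermiteReal (k : ℕ) : Polynomial ℝ :=
  (Polynomial.hermite k).map (Int.castRingHom ℝ)

/-! ### Hermite expansions: Laplace transform, orthogonality, Parseval -/

section Hermite

open Polynomial

theorem aeval_hermite_eq_eval_hermiteReal (k : ℕ) (x : ℝ) :
    aeval x (hermite k) = (hermiteReal k).eval x := by
  rw [aeval_def, eval₂_eq_eval_map]; rfl

theorem hermiteReal_zero : hermiteReal 0 = 1 := by simp [hermiteReal]

theorem hermiteReal_succ (k : ℕ) :
    hermiteReal (k + 1) = X * hermiteReal k - derivative (hermiteReal k) := by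
  simp [hermiteReal, derivative_map]

theorem monic_hermiteReal (k : ℕ) : (hermiteReal k).Monic := (hermite_monic k).map _

theorem natDegree_hermiteReal (k : ℕ) : (hermiteReal k).natDegree = k := by
  rw [hermiteReal, (hermite_monic k).natDegree_map, natDegree_hermite]

theorem integral_exp_stdGauss (t : ℝ) :
    ∫ x, Real.exp (t * x) ∂stdGauss = Real.exp (t ^ 2 / 2) := by
  have := congrFun (mgf_id_gaussianReal (μ := 0) (v := 1)) t
  simpa [mgf, stdGauss] using this

/-- The raising operator `p ↦ X p - p'` multiplies the Gaussian Laplace transform by `t`. -/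
theorem integral_exp_mul_hermiteReal (t : ℝ) (k : ℕ) :
    ∫ x, Real.exp (t * x) * (hermiteReal k).eval x ∂stdGauss
      = t ^ k * Real.exp (t ^ 2 / 2) := by
  induction k with
  | zero => simp [hermiteReal_zero, integral_exp_stdGauss]
  | succ k ih =>
    rw [hermiteReal_succ, integral_exp_mul_X_mul_sub_derivative, ih]; ring

/-- Integration by parts at `t = 0`, iterated. Orthogonality follows, because `k` derivatives kill
every polynomial of degree below `k`. -/
theorem integral_mul_hermiteReal (p : ℝ[X]) (k : ℕ) :
    ∫ x, (p * hermiteReal k).eval x ∂stdGauss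
      = ∫ x, (derivative^[k] p).eval x ∂stdGauss := by
  induction k generalizing p with
  | zero => simp [hermiteReal_zero]
  | succ k ih =>
    rw [Function.iterate_succ_apply, ← ih (derivative p)]
    have h := integral_exp_mul_X_mul_sub_derivative 0 (p * hermiteReal k)
    simp only [zero_mul, Real.exp_zero, one_mul] at h
    have h2 : p * hermiteReal (k + 1) = (X * (p * hermiteReal k)
        - derivative (p * hermiteReal k)) + derivative p * hermiteReal k := by
      rw [hermiteReal_succ, derivative_mul]; ring
    rw [h2]
    simp only [eval_add]
    rw [integral_add (integrable_polynomial_stdGauss _) (integrable_polynomial_stdGauss _), h,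
      zero_add]

theorem integral_mul_hermiteReal_of_natDegree_lt (p : ℝ[X]) {k : ℕ} (h : p.natDegree < k) :
    ∫ x, (p * hermiteReal k).eval x ∂stdGauss = 0 := by
  rw [integral_mul_hermiteReal, iterate_derivative_eq_zero h]; simp

theorem integral_hermiteReal_mul_hermiteReal (j k : ℕ) :
    ∫ x, (hermiteReal j * hermiteReal k).eval x ∂stdGauss
      = if j = k then (k.factorial : ℝ) else 0 := by
  rcases lt_trichotomy j k with h | h | h
  · rw [if_neg h.ne, integral_mul_hermiteReal_of_natDegree_lt _ (by rwa [natDegree_hermiteReal])]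
  · subst h
    rw [if_pos rfl, integral_mul_hermiteReal]
    have : derivative^[j] (hermiteReal j) = C (j.factorial : ℝ) := by
      rw [eq_C_of_natDegree_eq_zero (p := derivative^[j] (hermiteReal j))]
      · have h1 : (hermiteReal j).coeff j = 1 := by
          simpa [natDegree_hermiteReal] using (monic_hermiteReal j).coeff_natDegree
        simp [coeff_iterate_derivative, h1, Nat.descFactorial_self]
      · have := natDegree_iterate_derivative (hermiteReal j) j
        rw [natDegree_hermiteReal] at this
        omega
    simp [this]
  · rw [if_neg h.ne', mul_comm,
      integral_mul_hermiteReal_of_natDegree_lt _ (by rwa [natDegree_hermiteReal])]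

/-- The linear map which sends `X ^ k` to the `k`-th Hermite polynomial. -/
noncomputable def hermiteExpansion : ℝ[X] →ₗ[ℝ] ℝ[X] :=
  lsum fun k => LinearMap.toSpanSingleton ℝ ℝ[X] (hermiteReal k)

theorem hermiteExpansion_apply (c : ℝ[X]) :
    hermiteExpansion c = ∑ k ∈ c.support, c.coeff k • hermiteReal k := by
  simp [hermiteExpansion, lsum, Polynomial.sum_def]

theorem hermiteExpansion_monomial (k : ℕ) (a : ℝ) :
    hermiteExpansion (monomial k a) = a • hermiteReal k := by
  simp [hermiteExpansion, lsum]

theorem hermiteExpansion_one : hermiteExpansion 1 = 1 := by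
  have h := hermiteExpansion_monomial 0 1
  rwa [monomial_zero_one, hermiteReal_zero, one_smul] at h

theorem integral_exp_mul_hermiteExpansion (t : ℝ) (c : ℝ[X]) :
    ∫ x, Real.exp (t * x) * (hermiteExpansion c).eval x ∂stdGauss
      = Real.exp (t ^ 2 / 2) * c.eval t := by
  induction c using Polynomial.induction_on' with
  | add p q hp hq =>
    simp only [map_add, eval_add, mul_add]
    rw [integral_add (integrable_exp_mul_polynomial_stdGauss _ _)
      (integrable_exp_mul_polynomial_stdGauss _ _), hp, hq]
  | monomial n a =>
    rw [hermiteExpansion_monomial]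
    have h : ∀ x, Real.exp (t * x) * (a • hermiteReal n).eval x
      = a * (Real.exp (t * x) * (hermiteReal n).eval x) := fun x => by simp; ring
    simp_rw [h]
    rw [integral_const_mul, integral_exp_mul_hermiteReal, eval_monomial]; ring

theorem integral_hermiteExpansion_mul_hermiteReal (c : ℝ[X]) (k : ℕ) :
    ∫ x, (hermiteExpansion c * hermiteReal k).eval x ∂stdGauss = k.factorial * c.coeff k := by
  induction c using Polynomial.induction_on' with
  | add p q hp hq =>
    simp only [map_add, add_mul, eval_add, coeff_add, mul_add]
    rw [integral_add (integrable_polynomial_stdGauss _) (integrable_polynomial_stdGauss _), hp, hq]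
  | monomial n a =>
    rw [hermiteExpansion_monomial]
    simp only [smul_mul_assoc, eval_smul, smul_eq_mul]
    rw [integral_const_mul, integral_hermiteReal_mul_hermiteReal, coeff_monomial]
    split_ifs <;> simp [mul_comm]

/-- Parseval's identity for Hermite expansions. -/
theorem integral_hermiteExpansion_sq (c : ℝ[X]) :
    ∫ x, (hermiteExpansion c).eval x ^ 2 ∂stdGauss
      = ∑ k ∈ c.support, (k.factorial : ℝ) * c.coeff k ^ 2 := by
  have h : ∀ x, (hermiteExpansion c).eval x ^ 2
      = ∑ k ∈ c.support, c.coeff k * (hermiteExpansion c * hermiteReal k).eval x := fun x => by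
    rw [sq]
    conv_lhs => enter [1]; rw [hermiteExpansion_apply c, eval_finsetSum]
    rw [Finset.sum_mul]
    refine Finset.sum_congr rfl fun k _ => ?_
    simp; ring
  simp_rw [h]
  rw [integral_finsetSum _ fun k _ => (integrable_polynomial_stdGauss _).const_mul _]
  refine Finset.sum_congr rfl fun k _ => ?_
  rw [integral_const_mul, integral_hermiteExpansion_mul_hermiteReal]; ring

/-- Allows every polynomial density to be replaced by its coefficient polynomial. -/
theorem hermiteExpansion_surjective : Function.Surjective hermiteExpansion := by
  let S : Polynomial.Sequence ℝ :=
    ⟨hermiteReal, fun i => by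
      rw [degree_eq_natDegree (monic_hermiteReal i).ne_zero, natDegree_hermiteReal]⟩
  have hS := S.span fun i => by
    have : (S i).leadingCoeff = 1 := monic_hermiteReal i
    simp [this]
  rw [← LinearMap.range_eq_top, eq_top_iff, ← hS, Submodule.span_le]
  rintro _ ⟨k, rfl⟩
  exact ⟨monomial k 1, by rw [hermiteExpansion_monomial, one_smul]⟩

end Hermite

/-! ### Identification of a law from its moment generating function -/

theorem MeasureTheory.Measure.ext_of_mgf_id_eq {μ ν : Measure ℝ} [IsFiniteMeasure μ]
    [IsFiniteMeasure ν] (hint : ∀ t : ℝ, Integrable (fun x => Real.exp (t * x)) μ)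
    (h : mgf id μ = mgf id ν) : μ = ν := by
  have h0 : μ.real Set.univ = ν.real Set.univ := by simpa [mgf] using congrFun h 0
  have h00 : μ = 0 ↔ ν = 0 := by
    rw [← Measure.measure_univ_eq_zero, ← Measure.measure_univ_eq_zero (μ := ν),
      ← measureReal_eq_zero_iff, ← measureReal_eq_zero_iff, h0]
  have hset : integrableExpSet id μ = Set.univ := Set.eq_univ_of_forall hint
  -- The transform is finite on all of `ℝ`, so analytic continuation reaches the whole complex
  -- plane.
  refine Measure.ext_of_complexMGF_id_eq (funext fun z => ?_)
  exact eqOn_complexMGF_of_mgf' h h00 (by rw [hset]; simp)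

theorem stdGauss_withDensity_ofReal_integrable_exp (p : Polynomial ℝ) (t : ℝ) :
    Integrable (fun x => Real.exp (t * x))
      (stdGauss.withDensity fun x => ENNReal.ofReal (p.eval x)) ∧
    mgf id (stdGauss.withDensity fun x => ENNReal.ofReal (p.eval x)) t
      = ∫ x, Real.exp (t * x) * max (p.eval x) 0 ∂stdGauss := by
  have hm : Measurable fun x => ENNReal.ofReal (p.eval x) := by fun_prop
  have hf : ∀ᵐ x ∂stdGauss, ENNReal.ofReal (p.eval x) < ∞ := by simp
  constructor
  · rw [integrable_withDensity_iff_integrable_smul' hm hf]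
    simp only [smul_eq_mul]
    refine (integrable_exp_mul_polynomial_stdGauss t p).mono (by fun_prop) (ae_of_all _ fun x => ?_)
    rw [norm_mul, norm_mul, mul_comm]
    gcongr
    rw [ENNReal.toReal_ofReal']
    simpa using abs_max_le_max_abs_abs (a := p.eval x) (b := 0)
  · rw [mgf, integral_withDensity_eq_integral_toReal_smul hm hf]
    simp [ENNReal.toReal_ofReal', mul_comm]

instance (p : Polynomial ℝ) :
    IsFiniteMeasure (stdGauss.withDensity fun x => ENNReal.ofReal (p.eval x)) :=
  isFiniteMeasure_withDensity_ofReal (integrable_polynomial_stdGauss p).2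

/-- A measure with the moment generating function `e ^ (t² / 2) c(t)`, `c` a polynomial, has
the Hermite expansion of `c` as its density. -/
theorem eq_withDensity_hermiteExpansion_of_mgf {ν : Measure ℝ} [IsFiniteMeasure ν]
    (hint : ∀ t : ℝ, Integrable (fun x => Real.exp (t * x)) ν) (c : Polynomial ℝ)
    (h : ∀ t, mgf id ν t = Real.exp (t ^ 2 / 2) * c.eval t) :
    ν ≪ stdGauss ∧ (fun x => (ν.rnDeriv stdGauss x).toReal)
      =ᵐ[stdGauss] fun x => (hermiteExpansion c).eval x := by
  set q := hermiteExpansion c with hq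
  set μp := stdGauss.withDensity fun x => ENNReal.ofReal (q.eval x) with hμp
  set μm := stdGauss.withDensity fun x => ENNReal.ofReal ((-q).eval x) with hμm
  have hp := stdGauss_withDensity_ofReal_integrable_exp q
  have hn := stdGauss_withDensity_ofReal_integrable_exp (-q)
  rw [← hμp] at hp
  rw [← hμm] at hn
  -- The sign of `q` is not known in advance. Moving the negative part to the other side compares
  -- two positive measures.
  have key : μp = ν + μm := by
    refine Measure.ext_of_mgf_id_eq (fun t => (hp t).1) (funext fun t => ?_)
    rw [mgf_add_measure (X := id) (hint t) (hn t).1, h, (hp t).2, (hn t).2,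
      ← integral_exp_mul_hermiteExpansion]
    have hint' : ∀ p : Polynomial ℝ,
        Integrable (fun x => Real.exp (t * x) * max (p.eval x) 0) stdGauss := fun p => by
      refine (integrable_exp_mul_polynomial_stdGauss t p).mono (by fun_prop)
        (ae_of_all _ fun x => ?_)
      rw [norm_mul, norm_mul]
      gcongr
      simpa using abs_max_le_max_abs_abs (a := p.eval x) (b := 0)
    rw [← integral_add (integrable_exp_mul_polynomial_stdGauss t _) (hint' (-q))]
    refine integral_congr_ae (ae_of_all _ fun x => ?_)
    simp only [Polynomial.eval_neg, ← mul_add, ← hq]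
    congr 1
    rcases le_total (q.eval x) 0 with h | h
    · rw [max_eq_right h, max_eq_left (by linarith)]; ring
    · rw [max_eq_left h, max_eq_right (by linarith)]; ring
  have hle : ν ≤ μp := by rw [key]; exact Measure.le_add_right le_rfl
  have hac : ν ≪ stdGauss :=
    (Measure.absolutelyContinuous_of_le hle).trans (withDensity_absolutelyContinuous _ _)
  refine ⟨hac, ?_⟩
  have h1 : μp.rnDeriv stdGauss =ᵐ[stdGauss] fun x => ENNReal.ofReal (q.eval x) :=
    Measure.rnDeriv_withDensity _ (by fun_prop)
  have h2 : μm.rnDeriv stdGauss =ᵐ[stdGauss] fun x => ENNReal.ofReal ((-q).eval x) :=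
    Measure.rnDeriv_withDensity _ (by fun_prop)
  have h3 := Measure.rnDeriv_add ν μm stdGauss
  rw [← key] at h3
  filter_upwards [h1, h2, h3, ν.rnDeriv_lt_top stdGauss] with x e1 e2 e3 e4
  rw [e1, Pi.add_apply, e2] at e3
  have := congrArg ENNReal.toReal e3
  rw [ENNReal.toReal_add e4.ne (by simp), ENNReal.toReal_ofReal', ENNReal.toReal_ofReal',
    Polynomial.eval_neg] at this
  rcases le_total (q.eval x) 0 with h | h
  · rw [max_eq_right h, max_eq_left (by linarith)] at this; linarith
  · rw [max_eq_left h, max_eq_right (by linarith)] at this; linarith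

/-- The constant 1 is its own expansion, so the density minus 1 is the expansion of `c - 1` and
Parseval applies. -/
theorem chiTwo_stdGauss_of_mgf {ν : Measure ℝ} [IsFiniteMeasure ν]
    (hint : ∀ t : ℝ, Integrable (fun x => Real.exp (t * x)) ν) (c : Polynomial ℝ)
    (h : ∀ t, mgf id ν t = Real.exp (t ^ 2 / 2) * c.eval t) :
    chiTwo ν stdGauss = ENNReal.ofReal
      (∑ k ∈ (c - 1).support, (k.factorial : ℝ) * (c - 1).coeff k ^ 2) ^ (1 / 2 : ℝ) := by
  obtain ⟨hac, hd⟩ := eq_withDensity_hermiteExpansion_of_mgf hint c h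
  rw [chiTwo, if_pos hac, ← integral_hermiteExpansion_sq, ofReal_integral_eq_lintegral_ofReal]
  · congr 1
    refine lintegral_congr_ae ?_
    filter_upwards [hd] with x hx
    rw [hx, map_sub, hermiteExpansion_one]; simp
  · exact (integrable_polynomial_stdGauss (hermiteExpansion (c - 1) ^ 2)).congr
      (ae_of_all _ fun x => Polynomial.eval_pow _)
  · exact ae_of_all _ fun x => sq_nonneg _

/-! ### From Hypothesis (H) to a Gaussian bound, by a differential inequality -/

/-- The weighted inequality of arithmetic and geometric means with integer weights. -/
theorem pow_mul_pow_le_add_pow {x y : ℝ} (hx : 0 ≤ x) (hy : 0 ≤ y) {L M : ℕ} (hL : 0 < L)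
    (hM : 0 < M) :
    ((M + L : ℕ) : ℝ) ^ (M + L) * (x ^ L * y ^ M)
      ≤ (L : ℝ) ^ L * (M : ℝ) ^ M * (x + y) ^ (M + L) := by
  have hL' : (0 : ℝ) < L := by exact_mod_cast hL
  have hM' : (0 : ℝ) < M := by exact_mod_cast hM
  have hN' : (0 : ℝ) < ((M + L : ℕ) : ℝ) := by push_cast; positivity
  have hN0 : M + L ≠ 0 := by omega
  -- Dividing `x` and `y` by their weights makes the arithmetic mean `(x + y) / (M + L)`.
  have h := Real.geom_mean_le_arith_mean2_weighted (w₁ := L / ((M + L : ℕ) : ℝ))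
    (w₂ := M / ((M + L : ℕ) : ℝ)) (p₁ := x / L) (p₂ := y / M) (by positivity) (by positivity)
    (by positivity) (by positivity) (by push_cast at hN' ⊢; field_simp; ring)
  have h2 := pow_le_pow_left₀ (by positivity) h (M + L)
  rw [mul_pow, ← Real.rpow_mul_natCast (by positivity), ← Real.rpow_mul_natCast (by positivity),
    div_mul_cancel₀ _ hN'.ne', div_mul_cancel₀ _ hN'.ne', Real.rpow_natCast, Real.rpow_natCast,
    show (L / ((M + L : ℕ) : ℝ)) * (x / L) + (M / ((M + L : ℕ) : ℝ)) * (y / M)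
      = (x + y) / ((M + L : ℕ) : ℝ) by field_simp, div_pow, div_pow, div_pow,
    div_mul_div_comm, div_le_div_iff₀ (by positivity) (by positivity)] at h2
  linarith

/-- The weighted mean inequality for `1` and `b v^(M+L)`, with weights `L` and `M`, produces exactly
the power `v^M`; `h` compares the constants. -/
theorem mul_pow_le_one_add_mul_pow {a b : ℝ} (hb : 0 ≤ b) {M L : ℕ} (hM : 0 < M)
    (hL : 0 < L)
    (h : a ^ (M + L) * ((M : ℝ) ^ M * (L : ℝ) ^ L) ≤ b ^ M * ((M + L : ℕ) : ℝ) ^ (M + L))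
    {v : ℝ} (hv : 0 ≤ v) : a * v ^ M ≤ 1 + b * v ^ (M + L) := by
  have hL' : (0 : ℝ) < L := by exact_mod_cast hL
  have hM' : (0 : ℝ) < M := by exact_mod_cast hM
  refine le_of_pow_le_pow_left₀ (n := M + L) (by omega) (by positivity) ?_
  have h1 := pow_mul_pow_le_add_pow zero_le_one (by positivity : 0 ≤ b * v ^ (M + L)) hL hM
  have h2 := mul_le_mul_of_nonneg_right h (by positivity : 0 ≤ (v ^ (M + L)) ^ M)
  refine le_of_mul_le_mul_left (a := (L : ℝ) ^ L * (M : ℝ) ^ M) ?_ (by positivity)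
  calc (L : ℝ) ^ L * (M : ℝ) ^ M * (a * v ^ M) ^ (M + L)
      = a ^ (M + L) * ((M : ℝ) ^ M * (L : ℝ) ^ L) * (v ^ (M + L)) ^ M := by
        rw [mul_pow, ← pow_mul, ← pow_mul, mul_comm M]; ring
    _ ≤ _ := h2
    _ = ((M + L : ℕ) : ℝ) ^ (M + L) * (1 ^ L * (b * v ^ (M + L)) ^ M) := by
        rw [mul_pow]; ring
    _ ≤ _ := h1

/-- Clears denominators in (H2a). If `b = 0`, the second factor is `∞` and the bound forces `a = 0`.
-/
theorem pow_mul_pow_le_of_ennreal {a b : ℝ} (ha : 0 ≤ a) (hb : 0 ≤ b) {c M L : ℕ} (hc : 0 < c)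
    (hM : 0 < M)
    (h : (2 * (c : ℝ≥0∞) * ENNReal.ofReal a / ((M + L : ℕ) : ℝ≥0∞)) ^ (M + L)
      * ((M : ℝ≥0∞) / (2 * ENNReal.ofReal b)) ^ M ≤ 1 / (L : ℝ≥0∞) ^ L) :
    (2 * c * a) ^ (M + L) * ((M : ℝ) ^ M * (L : ℝ) ^ L)
      ≤ (2 * b) ^ M * ((M + L : ℕ) : ℝ) ^ (M + L) := by
  have hM' : (0 : ℝ) < M := by exact_mod_cast hM
  have hc' : (0 : ℝ) < c := by exact_mod_cast hc
  have hN' : (0 : ℝ) < ((M + L : ℕ) : ℝ) := by push_cast; positivity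
  have hLL : (0 : ℝ) < (L : ℝ) ^ L := by
    rcases Nat.eq_zero_or_pos L with rfl | h
    · simp
    · have : (0 : ℝ) < L := by exact_mod_cast h
      positivity
  have hrhs : 1 / (L : ℝ≥0∞) ^ L = ENNReal.ofReal (1 / (L : ℝ) ^ L) := by
    rw [ENNReal.ofReal_div_of_pos hLL, ENNReal.ofReal_pow (by positivity)]; simp
  have hlhs : 2 * (c : ℝ≥0∞) * ENNReal.ofReal a / ((M + L : ℕ) : ℝ≥0∞)
      = ENNReal.ofReal (2 * c * a / ((M + L : ℕ) : ℝ)) := by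
    rw [ENNReal.ofReal_div_of_pos hN', ENNReal.ofReal_mul (by positivity),
      ENNReal.ofReal_mul (by positivity)]
    simp only [ENNReal.ofReal_natCast, ENNReal.ofReal_ofNat]
  rw [hrhs, hlhs] at h
  rcases hb.eq_or_lt with rfl | hb
  · rcases ha.eq_or_lt with rfl | ha
    · simp [hM.ne']
    · exfalso
      have h1 : ((M : ℝ≥0∞) / (2 * ENNReal.ofReal 0)) ^ M = ∞ := by
        simp [ENNReal.div_zero, hM.ne']
      rw [h1, ENNReal.mul_top] at h
      · simp at h
      · refine pow_ne_zero _ (ENNReal.ofReal_pos.2 (by positivity)).ne'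
  · have h1 : (M : ℝ≥0∞) / (2 * ENNReal.ofReal b) = ENNReal.ofReal (M / (2 * b)) := by
      rw [ENNReal.ofReal_div_of_pos (by positivity), ENNReal.ofReal_mul (by positivity)]
      simp only [ENNReal.ofReal_natCast, ENNReal.ofReal_ofNat]
    rw [h1, ← ENNReal.ofReal_pow (by positivity), ← ENNReal.ofReal_pow (by positivity),
      ← ENNReal.ofReal_mul (by positivity), ENNReal.ofReal_le_ofReal_iff (by positivity),
      div_pow, div_pow, div_mul_div_comm, div_le_div_iff₀ (by positivity) hLL] at h
    linarith

/-- The left side is largest at `v² = N - 2`, where the bound on `g` makes it at most 1. -/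
theorem mul_pow_sub_two_mul_sub_sq_le {g v : ℝ} (hg : 0 ≤ g) (hv : 0 ≤ v) {N : ℕ} (hN : 3 ≤ N)
    (h : g ≤ 1 / (2 * ((N : ℝ) - 2) ^ (((N : ℝ) - 2) / 2))) :
    g * v ^ (N - 2) * (N - v ^ 2) ≤ 1 := by
  obtain ⟨m, rfl⟩ : ∃ m, N = m + 2 := ⟨N - 2, by omega⟩
  have hm : 0 < m := by omega
  have hm' : (0 : ℝ) < m := by exact_mod_cast hm
  simp only [Nat.cast_add, Nat.cast_ofNat, add_sub_cancel_right, Nat.add_sub_cancel] at h ⊢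
  rcases le_or_gt ((m : ℝ) + 2) (v ^ 2) with hle | hlt
  · have : g * v ^ m * (m + 2 - v ^ 2) ≤ 0 :=
      mul_nonpos_of_nonneg_of_nonpos (by positivity) (by linarith)
    linarith
  have hs : 0 < (m : ℝ) + 2 - v ^ 2 := by linarith
  -- The two bases `N - v²` and `v²` have a sum independent of `v`.
  have key := pow_mul_pow_le_add_pow hs.le (sq_nonneg v) two_pos hm
  rw [sub_add_cancel] at key
  have hcast : ((m + 2 : ℕ) : ℝ) = (m : ℝ) + 2 := by push_cast; ring
  rw [hcast, mul_comm (_ ^ _) ((_ : ℝ) * _)] at key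
  have key2 := le_of_mul_le_mul_right key (by positivity)
  have hg2 : g ^ 2 * (4 * (m : ℝ) ^ m) ≤ 1 := by
    have h3 := pow_le_pow_left₀ hg h 2
    rw [div_pow, mul_pow, ← Real.rpow_mul_natCast hm'.le, Nat.cast_ofNat,
      div_mul_cancel₀ _ two_ne_zero, Real.rpow_natCast, one_pow,
      le_div_iff₀ (by positivity)] at h3
    linarith
  refine le_of_pow_le_pow_left₀ (n := 2) two_ne_zero zero_le_one ?_
  calc (g * v ^ m * (m + 2 - v ^ 2)) ^ 2
      = g ^ 2 * (((m : ℝ) + 2 - v ^ 2) ^ 2 * (v ^ 2) ^ m) := by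
        rw [mul_pow, mul_pow, ← pow_mul, ← pow_mul, mul_comm 2 m]; ring
    _ ≤ g ^ 2 * (((2 : ℕ) : ℝ) ^ 2 * (m : ℝ) ^ m) := by gcongr
    _ ≤ 1 ^ 2 := by norm_num at hg2 ⊢; exact hg2

/-- The differential inequality `q' ≤ v (1 + q)` for `q = ∑ γ k v ^ k`. -/
theorem sum_deriv_le {γ : ℕ → ℝ} (hγ : ∀ k, 0 ≤ γ k) {K N : ℕ} (hK : 3 ≤ K) (hKN : K ≤ N)
    (h1 : HypH1 γ K N) (h2a : HypH2a γ K N) (h2b : HypH2b γ K N) {v : ℝ} (hv : 0 ≤ v) :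
    ∑ j ∈ Finset.range (N + 1 - K), γ (K + j) * (((K + j : ℕ) : ℝ) * v ^ (K + j - 1))
      ≤ v * (1 + ∑ j ∈ Finset.range (N + 1 - K), γ (K + j) * v ^ (K + j)) := by
  rcases hKN.eq_or_lt with rfl | hlt
  · have h := mul_pow_sub_two_mul_sub_sq_le (hγ K) hv hK (h2b rfl)
    obtain ⟨m, rfl⟩ : ∃ m, K = m + 2 := ⟨K - 2, by omega⟩
    simp only [Nat.add_sub_cancel_left, Finset.range_one, Finset.sum_singleton, add_zero,
      Nat.add_sub_cancel, show m + 2 - 1 = m + 1 by omega] at h ⊢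
    have := mul_le_mul_of_nonneg_left h hv
    linear_combination this
  · obtain ⟨m, rfl⟩ : ∃ m, N = K + 1 + m := ⟨N - K - 1, by omega⟩
    obtain ⟨l, rfl⟩ : ∃ l, K = l + 2 := ⟨K - 2, by omega⟩
    have hl : 0 < l := by omega
    have h2 := h2a (by omega)
    rw [max_le_iff] at h2
    obtain ⟨ha, hb⟩ := h2
    have e1 : l + 2 + 1 + m - (l + 2) + 1 = m + 2 := by omega
    rw [e1, show l + 2 + 1 + m = l + 1 + (m + 2) by ring, show l + 2 - 1 = l + 1 by omega] at ha
    rw [e1, show l + 2 + 1 + m - 1 = l + (m + 2) by omega, show l + 2 - 2 = l by omega] at hb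
    -- (H2a) controls the two lowest terms of `q'`, which (H1) does not reach, by the two highest
    -- terms of `q`. The factors 2 let each of the two inequalities use half of the constant 1.
    have hA := mul_pow_le_one_add_mul_pow
      (by have := hγ (l + 1 + (m + 2)); positivity) (Nat.succ_pos l) (Nat.succ_pos _)
      (pow_mul_pow_le_of_ennreal (hγ _) (hγ _) (by omega) (Nat.succ_pos l) ha) hv
    have hB := mul_pow_le_one_add_mul_pow
      (by have := hγ (l + (m + 2)); positivity) hl (Nat.succ_pos _)
      (pow_mul_pow_le_of_ennreal (hγ _) (hγ _) (by omega) hl hb) hv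
    have hsum : ∑ j ∈ Finset.range m, γ (l + 2 + (j + 2)) *
          (((l + 2 + (j + 2) : ℕ) : ℝ) * v ^ (l + 2 + (j + 2) - 1))
        ≤ v * ∑ j ∈ Finset.range m, γ (l + 2 + j) * v ^ (l + 2 + j) := by
      rw [Finset.mul_sum]
      refine Finset.sum_le_sum fun j hj => ?_
      have hj' := Finset.mem_range.1 hj
      have := h1 (l + 2 + j) (by omega) (by omega)
      have h3 := mul_le_mul_of_nonneg_right this (by positivity : 0 ≤ v ^ (l + 2 + j + 1))
      rw [show l + 2 + (j + 2) - 1 = l + 2 + j + 1 by omega]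
      rw [show l + 2 + j + 2 = l + 2 + (j + 2) by ring] at h3
      push_cast at h3 ⊢
      rw [pow_succ] at h3 ⊢
      linear_combination h3
    rw [show l + 2 + 1 + m + 1 - (l + 2) = m + 2 by omega]
    -- Peel the two lowest terms off `q'` and the two highest off `q`; (H1) compares the rest
    -- termwise with index shift 2.
    rw [Finset.sum_range_succ', Finset.sum_range_succ' _ m, Finset.sum_range_succ _ (m + 1),
      Finset.sum_range_succ _ m]
    have hA' := mul_le_mul_of_nonneg_left hA hv
    have hB' := mul_le_mul_of_nonneg_left hB hv
    simp only [add_zero, zero_add, show l + 2 + 1 - 1 = l + 2 by omega,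
      show l + 2 - 1 = l + 1 by omega] at hsum ⊢
    rw [show l + (m + 2) = l + 2 + m by ring] at hB'
    rw [show l + 1 + (m + 2) = l + 2 + (m + 1) by ring] at hA'
    simp only [add_assoc] at hsum hA' hB' ⊢
    norm_num at hsum hA' hB' ⊢
    linear_combination hsum + hA' / 2 + hB' / 2

/-- By `sum_deriv_le`, `q(v) exp (-v²/2)` is nonincreasing on `[0, ∞)`, and it equals 1 at 0. -/
theorem one_add_sum_le_exp {γ : ℕ → ℝ} (hγ : ∀ k, 0 ≤ γ k) {K N : ℕ} (hK : 3 ≤ K) (hKN : K ≤ N)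
    (h1 : HypH1 γ K N) (h2a : HypH2a γ K N) (h2b : HypH2b γ K N) {v : ℝ} (hv : 0 ≤ v) :
    1 + ∑ j ∈ Finset.range (N + 1 - K), γ (K + j) * v ^ (K + j) ≤ Real.exp (v ^ 2 / 2) := by
  let q : ℝ → ℝ := fun v => 1 + ∑ j ∈ Finset.range (N + 1 - K), γ (K + j) * v ^ (K + j)
  have hq (v : ℝ) : HasDerivAt q (∑ j ∈ Finset.range (N + 1 - K),
      γ (K + j) * (((K + j : ℕ) : ℝ) * v ^ (K + j - 1))) v :=
    (HasDerivAt.fun_sum fun j _ => (hasDerivAt_pow (K + j) v).const_mul _).const_add 1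
  have he (v : ℝ) : HasDerivAt (fun v : ℝ => Real.exp (-(v ^ 2 / 2)))
      (Real.exp (-(v ^ 2 / 2)) * -v) v := by
    have := (((hasDerivAt_pow 2 v).div_const 2).fun_neg).exp
    convert! this using 1
    push_cast; ring
  have hd (v : ℝ) := (hq v).fun_mul (he v)
  have hanti : AntitoneOn (fun v => q v * Real.exp (-(v ^ 2 / 2))) (Set.Ici 0) := by
    refine antitoneOn_of_deriv_nonpos (convex_Ici 0)
      (fun x _ => (hd x).continuousAt.continuousWithinAt)
      (fun x _ => (hd x).differentiableAt.differentiableWithinAt) fun x hx => ?_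
    rw [interior_Ici] at hx
    rw [(hd x).deriv]
    have h := sum_deriv_le hγ hK hKN h1 h2a h2b (le_of_lt hx)
    have h' := mul_le_mul_of_nonneg_right h (Real.exp_pos (-(x ^ 2 / 2))).le
    simp only [q]
    linear_combination h'
  have h0 := hanti Set.self_mem_Ici (Set.mem_Ici.2 hv) hv
  have hq0 : q 0 = 1 := by
    simp only [q, add_eq_left]
    refine Finset.sum_eq_zero fun j _ => ?_
    rw [zero_pow (by omega), mul_zero]
  simp only [hq0] at h0
  rw [Real.exp_neg, ← div_eq_mul_inv, div_le_iff₀ (Real.exp_pos _)] at h0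
  simpa [q] using h0

/-! ### Majorant polynomials and the factorially weighted sum -/

section AbsCoeff

open Polynomial

/-- The polynomial whose coefficients are the absolute values of those of `c`. -/
noncomputable def absCoeff (c : ℝ[X]) : ℝ[X] :=
  ∑ k ∈ c.support, monomial k |c.coeff k|

theorem coeff_absCoeff (c : ℝ[X]) (k : ℕ) : (absCoeff c).coeff k = |c.coeff k| := by
  simp only [absCoeff, finsetSum_coeff, coeff_monomial, Finset.sum_ite_eq', mem_support_iff]
  split_ifs with h
  · rfl
  · simp [not_not.1 h]

theorem abs_coeff_prod_le {ι : Type*} (s : Finset ι) (c : ι → ℝ[X]) (k : ℕ) :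
    |(∏ i ∈ s, c i).coeff k| ≤ (∏ i ∈ s, absCoeff (c i)).coeff k := by
  classical
  induction s using Finset.induction_on generalizing k with
  | empty => simp [coeff_one]; split_ifs <;> simp
  | insert i s hi ih =>
    rw [Finset.prod_insert hi, Finset.prod_insert hi, coeff_mul, coeff_mul]
    refine (Finset.abs_sum_le_sum_abs _ _).trans (Finset.sum_le_sum fun x _ => ?_)
    rw [abs_mul, coeff_absCoeff]
    exact mul_le_mul_of_nonneg_left (ih _) (abs_nonneg _)

theorem one_le_eval_absCoeff {c : ℝ[X]} (h0 : c.coeff 0 = 1) {t : ℝ} (ht : 0 ≤ t) :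
    1 ≤ (absCoeff c).eval t := by
  rw [eval_eq_sum_range, Finset.sum_range_succ']
  have : 0 ≤ ∑ k ∈ Finset.range (absCoeff c).natDegree,
      (absCoeff c).coeff (k + 1) * t ^ (k + 1) :=
    Finset.sum_nonneg fun k _ => by rw [coeff_absCoeff]; positivity
  simpa [coeff_absCoeff, h0] using this

/-- The exponential integral which dominates a factorially weighted sum of squares of nonnegative
coefficients. -/
theorem sum_factorial_mul_sq_le {B : ℝ[X]} (hB : ∀ k, 0 ≤ B.coeff k) (h0 : B.coeff 0 = 1)
    (n : ℕ) {A : ℝ} {K : ℕ}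
    (hbound : ∀ t : ℝ, 0 ≤ t →
      B.eval t - 1 ≤ n * A * t ^ K * Real.exp (n * t ^ 2 / 4)) (hn : 0 < n) :
    ∑ k ∈ Finset.Ico 1 (B.natDegree + 1), (k.factorial : ℝ) * (B.coeff k ^ 2 / (n : ℝ) ^ k)
      ≤ n ^ 2 * A ^ 2 / (n : ℝ) ^ K * (K.factorial * 2 ^ (K + 1)) := by
  have hn' : (0 : ℝ) < n := by exact_mod_cast hn
  have hint (k : ℕ) {b : ℝ} (hb : 0 < b) :
      IntegrableOn (fun x : ℝ => x ^ k * Real.exp (-(b * x))) (Set.Ioi 0) := by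
    have := integrableOn_rpow_mul_exp_neg_mul_rpow (p := 1) (s := k) (b := b)
      (by have : (0 : ℝ) ≤ k := k.cast_nonneg
          linarith) one_pos hb
    simpa using this
  have hval (k : ℕ) {b : ℝ} (hb : 0 < b) :
      ∫ x in Set.Ioi (0 : ℝ), x ^ k * Real.exp (-(b * x)) = (1 / b) ^ (k + 1) * k.factorial := by
    have := Real.integral_rpow_mul_exp_neg_mul_Ioi (a := k + 1) (by positivity) hb
    rw [add_sub_cancel_right, Real.Gamma_nat_eq_factorial] at this
    exact_mod_cast this
  have hpoint (x : ℝ) (hx : 0 < x) :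
      ∑ k ∈ Finset.Ico 1 (B.natDegree + 1),
        B.coeff k ^ 2 / (n : ℝ) ^ k * (x ^ k * Real.exp (-(1 * x)))
      ≤ n ^ 2 * A ^ 2 / (n : ℝ) ^ K * (x ^ K * Real.exp (-(1 / 2 * x))) := by
    -- With this choice `exp (n t²/4)² = exp (x/2)`, which leaves `exp (-x/2)` against the weight
    -- `exp (-x)`.
    set t := √(x / n) with ht
    have ht2 : t ^ 2 = x / n := Real.sq_sqrt (by positivity)
    have htk (k : ℕ) : x ^ k / (n : ℝ) ^ k = (t ^ k) ^ 2 := by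
      rw [← pow_mul, mul_comm k, pow_mul, ht2, div_pow]
    have hsum : ∑ k ∈ Finset.Ico 1 (B.natDegree + 1), B.coeff k * t ^ k = B.eval t - 1 := by
      rw [eval_eq_sum_range, Finset.range_eq_Ico,
        Finset.sum_eq_sum_Ico_succ_bot (Nat.succ_pos _)]
      simp [h0]
    have h1 := hbound t (Real.sqrt_nonneg _)
    have h2 : 0 ≤ B.eval t - 1 := hsum ▸ Finset.sum_nonneg fun k _ =>
      mul_nonneg (hB k) (by positivity)
    have h3 := pow_le_pow_left₀ h2 h1 2
    have h4 : ∑ k ∈ Finset.Ico 1 (B.natDegree + 1), (B.coeff k * t ^ k) ^ 2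
        ≤ (B.eval t - 1) ^ 2 := by
      rw [← hsum]
      exact Finset.sum_sq_le_sq_sum_of_nonneg fun k _ => mul_nonneg (hB k) (by positivity)
    calc _ = (∑ k ∈ Finset.Ico 1 (B.natDegree + 1), (B.coeff k * t ^ k) ^ 2)
          * Real.exp (-x) := by
          rw [Finset.sum_mul]
          refine Finset.sum_congr rfl fun k _ => ?_
          rw [mul_pow, ← htk, one_mul]; ring
      _ ≤ (n * A * t ^ K * Real.exp (n * t ^ 2 / 4)) ^ 2 * Real.exp (-x) := by
          gcongr; exact h4.trans h3
      _ = n ^ 2 * A ^ 2 * (t ^ K) ^ 2 * (Real.exp (n * t ^ 2 / 4) ^ 2 * Real.exp (-x)) := by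
          ring
      _ = _ := by
          rw [← htk, ← Real.exp_nat_mul, ← Real.exp_add, ht2]
          have : ((2 : ℕ) : ℝ) * (n * (x / n) / 4) + -x = -(1 / 2 * x) := by
            push_cast; field_simp; ring
          rw [this]; ring
  calc _ = ∫ x in Set.Ioi (0 : ℝ), ∑ k ∈ Finset.Ico 1 (B.natDegree + 1),
        B.coeff k ^ 2 / (n : ℝ) ^ k * (x ^ k * Real.exp (-(1 * x))) := by
        rw [integral_finsetSum _ fun k _ => (hint k one_pos).const_mul _]
        refine Finset.sum_congr rfl fun k _ => ?_
        rw [integral_const_mul, hval k one_pos]; simp; ring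
    _ ≤ ∫ x in Set.Ioi (0 : ℝ), n ^ 2 * A ^ 2 / (n : ℝ) ^ K *
          (x ^ K * Real.exp (-(1 / 2 * x))) :=
        setIntegral_mono_on (integrable_finsetSum _ fun k _ => (hint k one_pos).const_mul _)
          ((hint K (by norm_num)).const_mul _) measurableSet_Ioi hpoint
    _ = _ := by
        rw [integral_const_mul, hval K (by norm_num), one_div_one_div]; ring

/-- Telescoping: adding the factor `p n` increases the product by `(∏ p i) (p n - 1) ≤ e^n · a e`.
-/
theorem prod_sub_one_le (n : ℕ) (p : ℕ → ℝ) {e a : ℝ} (ha : 0 ≤ a) (he : 1 ≤ e)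
    (h1 : ∀ i < n, 1 ≤ p i) (h2 : ∀ i < n, p i ≤ e) (h3 : ∀ i < n, p i - 1 ≤ a * e) :
    ∏ i ∈ Finset.range n, p i - 1 ≤ n * a * e ^ n := by
  induction n with
  | zero => simp
  | succ n ih =>
    have ih := ih (fun i hi => h1 i (by omega)) (fun i hi => h2 i (by omega))
      (fun i hi => h3 i (by omega))
    have hp : ∏ i ∈ Finset.range n, p i ≤ e ^ n := by
      refine (Finset.prod_le_prod (fun i hi => ?_) fun i hi => ?_).trans_eq
        (Finset.prod_const e |>.trans (by simp))
      · have := h1 i (by have := Finset.mem_range.1 hi; omega); linarith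
      · exact h2 i (by have := Finset.mem_range.1 hi; omega)
    rw [Finset.prod_range_succ]
    have ha3 := h3 n (by omega)
    have ha1 := h1 n (by omega)
    have hen : 0 < e ^ n := by positivity
    have s1 := mul_le_mul_of_nonneg_right hp (by linarith : 0 ≤ p n - 1)
    have s2 := mul_le_mul_of_nonneg_left ha3 hen.le
    have s3 : n * a * e ^ n ≤ n * a * e ^ n * e := le_mul_of_one_le_right (by positivity) he
    push_cast
    rw [pow_succ]
    linear_combination ih + s1 + s2 + s3

end AbsCoeff

/-! ### Moment matching and Hypothesis (H) in terms of the coefficients -/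

section Hypotheses

open Polynomial

theorem hermiteCoeff_hermiteExpansion (c : ℝ[X]) (k : ℕ) :
    hermiteCoeff (hermiteExpansion c) k = √(k.factorial : ℝ) * c.coeff k := by
  have h : ∀ x, (hermiteExpansion c).eval x * (aeval x (hermite k) / √(k.factorial : ℝ))
      = (√(k.factorial : ℝ))⁻¹ * (hermiteExpansion c * hermiteReal k).eval x := fun x => by
    rw [aeval_hermite_eq_eval_hermiteReal, eval_mul]; ring
  simp_rw [hermiteCoeff, h]
  rw [integral_const_mul, integral_hermiteExpansion_mul_hermiteReal]
  have : (√(k.factorial : ℝ)) ≠ 0 := by positivity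
  field_simp
  rw [Real.sq_sqrt (by positivity)]

theorem integral_mul_of_momentsMatch {r : ℕ} {φ : ℝ[X]} (hφ : IsGaussDensity φ)
    (hm : MomentsMatch r φ) {p : ℝ[X]} (hp : p.natDegree ≤ r) :
    ∫ x, (φ * p).eval x ∂stdGauss = ∫ x, p.eval x ∂stdGauss := by
  have hk (k : ℕ) (hk : k ≤ r) :
      ∫ x, (φ * X ^ k).eval x ∂stdGauss = ∫ x, (X ^ k : ℝ[X]).eval x ∂stdGauss := by
    rcases Nat.eq_zero_or_pos k with rfl | h
    · simpa using hφ.2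
    · have := hm k (Finset.mem_Icc.2 ⟨h, hk⟩)
      simpa [mul_comm] using this
  have e1 : ∀ x, (φ * p).eval x
      = ∑ k ∈ Finset.range (r + 1), p.coeff k * (φ * X ^ k).eval x := fun x => by
    rw [eval_mul, eval_eq_sum_range' (Nat.lt_succ_of_le hp), Finset.mul_sum]
    exact Finset.sum_congr rfl fun k _ => by simp; ring
  have e2 : ∀ x, p.eval x
      = ∑ k ∈ Finset.range (r + 1), p.coeff k * (X ^ k : ℝ[X]).eval x := fun x => by
    rw [eval_eq_sum_range' (Nat.lt_succ_of_le hp)]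
    exact Finset.sum_congr rfl fun k _ => by simp
  simp_rw [e1]
  rw [integral_congr_ae (ae_of_all _ e2),
    integral_finsetSum _ fun k _ => (integrable_polynomial_stdGauss _).const_mul _,
    integral_finsetSum _ fun k _ => (integrable_polynomial_stdGauss _).const_mul _]
  refine Finset.sum_congr rfl fun k hk' => ?_
  rw [integral_const_mul, integral_const_mul, hk k (by have := Finset.mem_range.1 hk'; omega)]

/-- For `k ≤ r`, `k! c_k` is the integral of `H_k` under the density, hence also under the Gaussian,
where it vanishes for `k ≥ 1`. -/
theorem coeff_eq_of_momentsMatch {r : ℕ} {c : ℝ[X]} (hφ : IsGaussDensity (hermiteExpansion c))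
    (hm : MomentsMatch r (hermiteExpansion c)) :
    c.coeff 0 = 1 ∧ ∀ k, 1 ≤ k → k ≤ r → c.coeff k = 0 := by
  have h (k : ℕ) (hk : k ≤ r) :
      k.factorial * c.coeff k = ∫ x, (hermiteReal k).eval x ∂stdGauss := by
    rw [← integral_hermiteExpansion_mul_hermiteReal,
      integral_mul_of_momentsMatch hφ hm (by rwa [natDegree_hermiteReal])]
  constructor
  · simpa [hermiteReal_zero] using h 0 (Nat.zero_le _)
  · intro k hk hkr
    have h1 := h k hkr
    have h2 := integral_mul_hermiteReal_of_natDegree_lt 1 (k := k) (by rw [natDegree_one]; exact hk)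
    rw [one_mul] at h2
    rw [h2] at h1
    simpa [k.factorial_ne_zero] using h1

theorem coeff_eq_zero_of_natDegree_hermiteExpansion_lt {c : ℝ[X]} {k : ℕ}
    (h : (hermiteExpansion c).natDegree < k) : c.coeff k = 0 := by
  have h1 := integral_hermiteExpansion_mul_hermiteReal c k
  rw [integral_mul_hermiteReal_of_natDegree_lt _ h] at h1
  simpa [k.factorial_ne_zero] using h1.symm

/-- If the degree is at most `r`, truncated subtraction makes the sum empty, in accordance with `φ =
1`. -/
theorem eval_absCoeff_eq {r : ℕ} {c : ℝ[X]} (hφ : IsGaussDensity (hermiteExpansion c))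
    (hm : MomentsMatch r (hermiteExpansion c)) (t : ℝ) :
    (absCoeff c).eval t = 1 + ∑ j ∈ Finset.range ((hermiteExpansion c).natDegree + 1 - (r + 1)),
      |c.coeff (r + 1 + j)| * t ^ (r + 1 + j) := by
  obtain ⟨h0, h1⟩ := coeff_eq_of_momentsMatch hφ hm
  set N := (hermiteExpansion c).natDegree
  have hdeg : (absCoeff c).natDegree < r + 1 + (N + 1 - (r + 1)) := by
    refine (natDegree_le_iff_coeff_eq_zero (n := r + (N + 1 - (r + 1))).2 fun k hk => ?_).trans_lt
      (by omega)
    rw [coeff_absCoeff, coeff_eq_zero_of_natDegree_hermiteExpansion_lt (by omega), abs_zero]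
  rw [eval_eq_sum_range' hdeg, Finset.sum_range_add]
  simp only [coeff_absCoeff]
  congr 1
  rw [Finset.sum_range_succ']
  simp only [h0, pow_zero, abs_one, mul_one, add_eq_right]
  refine Finset.sum_eq_zero fun k hk => ?_
  rw [h1 (k + 1) (by omega) (by have := Finset.mem_range.1 hk; omega), abs_zero, zero_mul]

/-- Hypothesis (H) bounds the moment generating function. -/
theorem eval_absCoeff_le_exp {r : ℕ} (hr : 2 ≤ r) {c : ℝ[X]}
    (hφ : IsGaussDensity (hermiteExpansion c)) (hm : MomentsMatch r (hermiteExpansion c))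
    (hH : HypH r (hermiteExpansion c)) {t : ℝ} (ht : 0 ≤ t) :
    (absCoeff c).eval t ≤ Real.exp (t ^ 2 / 4) := by
  rw [eval_absCoeff_eq hφ hm]
  set N := (hermiteExpansion c).natDegree with hN
  rcases lt_or_ge N (r + 1) with hlt | hge
  · rw [show N + 1 - (r + 1) = 0 by omega]
    simpa using Real.one_le_exp (by positivity)
  set d : ℝ := 1 + (N : ℝ) / ((r + 1 : ℕ) : ℝ) with hd
  have hd2 : 2 ≤ d := by
    have : (1 : ℝ) ≤ (N : ℝ) / ((r + 1 : ℕ) : ℝ) := by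
      rw [one_le_div (by positivity)]; exact_mod_cast hge
    linarith
  have hs : 0 < √d := Real.sqrt_pos.2 (by linarith)
  have hγ (k : ℕ) : gammaCoeff r (hermiteExpansion c) k = √d ^ k * |c.coeff k| := by
    have hk : √(k.factorial : ℝ) ≠ 0 := by positivity
    have hpow : d ^ ((k : ℝ) / 2) = √d ^ k := by
      rw [Real.sqrt_eq_rpow, ← Real.rpow_mul_natCast (by linarith), one_div_mul_eq_div]
    rw [gammaCoeff, hermiteCoeff_hermiteExpansion, abs_mul, abs_of_nonneg (Real.sqrt_nonneg _),
      ← hN, ← hd, hpow]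
    field_simp
  -- At `v = t/√d` the weights `√d^k` in `γ` cancel, and `exp (v²/2) = exp (t²/(2d)) ≤ exp (t²/4)`
  -- because `N ≥ K` gives `d ≥ 2`.
  have key := one_add_sum_le_exp (γ := gammaCoeff r (hermiteExpansion c)) (K := r + 1) (N := N)
    (fun k => by rw [hγ]; positivity) (by omega) hge hH.1 hH.2.1 hH.2.2
    (div_nonneg ht hs.le)
  have hterm (k : ℕ) : gammaCoeff r (hermiteExpansion c) k * (t / √d) ^ k
      = |c.coeff k| * t ^ k := by
    rw [hγ, div_pow]; field_simp
  simp_rw [hterm] at key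
  refine key.trans (Real.exp_le_exp.2 ?_)
  rw [div_pow, Real.sq_sqrt (by linarith), div_div]
  exact div_le_div_of_nonneg_left (sq_nonneg _) (by norm_num) (by linarith)

theorem exists_eval_absCoeff_sub_one_le {r : ℕ} (hr : 2 ≤ r) {c : ℝ[X]}
    (hφ : IsGaussDensity (hermiteExpansion c)) (hm : MomentsMatch r (hermiteExpansion c))
    (hH : HypH r (hermiteExpansion c)) :
    ∃ A : ℝ, 0 ≤ A ∧ ∀ t : ℝ, 0 ≤ t →
      (absCoeff c).eval t - 1 ≤ A * t ^ (r + 1) * Real.exp (t ^ 2 / 4) := by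
  set L := (hermiteExpansion c).natDegree + 1 - (r + 1) with hL
  set S : ℝ := ∑ j ∈ Finset.range L, |c.coeff (r + 1 + j)| with hS
  have hS0 : 0 ≤ S := Finset.sum_nonneg fun _ _ => abs_nonneg _
  -- `S` suffices for `t ≤ 1`; the added 1 makes the prefactor at least 1 for `t ≥ 1`, where the
  -- bound `exp (t²/4)` is enough.
  refine ⟨S + 1, by positivity, fun t ht => ?_⟩
  have he : 1 ≤ Real.exp (t ^ 2 / 4) := Real.one_le_exp (by positivity)
  rcases le_total t 1 with h | h
  · rw [eval_absCoeff_eq hφ hm, add_sub_cancel_left, ← hL]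
    calc _ ≤ ∑ j ∈ Finset.range L, |c.coeff (r + 1 + j)| * t ^ (r + 1) := by
          refine Finset.sum_le_sum fun j _ => ?_
          exact mul_le_mul_of_nonneg_left (pow_le_pow_of_le_one ht h (by omega)) (abs_nonneg _)
      _ = S * t ^ (r + 1) * 1 := by rw [← Finset.sum_mul, mul_one]
      _ ≤ _ := by gcongr; linarith
  · have h1 := eval_absCoeff_le_exp hr hφ hm hH ht
    have h2 : 1 ≤ (S + 1) * t ^ (r + 1) :=
      one_le_mul_of_one_le_of_one_le (by linarith) (one_le_pow₀ h)
    have h3 := mul_le_mul_of_nonneg_right h2 (Real.exp_pos (t ^ 2 / 4)).le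
    linarith

end Hypotheses

/-! ### Renormalized sums of independent variables -/

section Sums

open Polynomial

theorem mgf_id_polyLaw_hermiteExpansion {c : ℝ[X]} (hφ : IsGaussDensity (hermiteExpansion c))
    (t : ℝ) : mgf id (polyLaw (hermiteExpansion c)) t = Real.exp (t ^ 2 / 2) * c.eval t := by
  rw [polyLaw, (stdGauss_withDensity_ofReal_integrable_exp _ t).2,
    ← integral_exp_mul_hermiteExpansion]
  exact integral_congr_ae (ae_of_all _ fun x => by simp only [max_eq_left (hφ.1 x)])

variable {Ω : Type*} [MeasurableSpace Ω] {P : Measure Ω} {X : ℕ → Ω → ℝ}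

theorem integrable_exp_mul_of_hasLaw_polyLaw {Y : Ω → ℝ} {φ : ℝ[X]}
    (hY : HasLaw Y (polyLaw φ) P) (t : ℝ) : Integrable (fun ω => Real.exp (t * Y ω)) P := by
  have h := (stdGauss_withDensity_ofReal_integrable_exp φ t).1
  have h2 : Integrable (fun x => Real.exp (t * x)) (P.map Y) := by rw [hY.map_eq]; exact h
  exact (integrable_map_measure (by fun_prop) hY.aemeasurable).1 h2

theorem aemeasurable_renormSum (hX : ∀ i, AEMeasurable (X i) P) (n : ℕ) :
    AEMeasurable (renormSum X n) P :=
  (Finset.aemeasurable_fun_sum _ fun i _ => hX i).div_const _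

theorem mgf_map_renormSum (hindep : iIndepFun X P) (hX : ∀ i, AEMeasurable (X i) P) (n : ℕ)
    (t : ℝ) : mgf id (P.map (renormSum X n)) t
      = ∏ i ∈ Finset.range n, mgf (X i) P (t / √(n : ℝ)) := by
  rw [mgf_id_map (aemeasurable_renormSum hX n), ← hindep.mgf_sum₀ hX]
  refine integral_congr_ae (ae_of_all _ fun ω => ?_)
  simp only [renormSum, Finset.sum_apply]
  congr 1; ring

theorem integrable_exp_mul_map_renormSum [IsProbabilityMeasure P]
    (hindep : iIndepFun X P) {φ : ℕ → ℝ[X]}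
    (hlaw : ∀ i, HasLaw (X i) (polyLaw (φ i)) P) (n : ℕ) (t : ℝ) :
    Integrable (fun x => Real.exp (t * x)) (P.map (renormSum X n)) := by
  -- A divergent integral would have the default value 0, whereas the product of the factors'
  -- transforms is positive.
  by_contra h
  have h0 : mgf id (P.map (renormSum X n)) t = 0 := integral_undef h
  rw [mgf_map_renormSum hindep (fun i => (hlaw i).aemeasurable)] at h0
  exact (Finset.prod_pos fun i _ =>
    mgf_pos (integrable_exp_mul_of_hasLaw_polyLaw (hlaw i) _)).ne' h0

theorem mgf_map_renormSum_eq (hindep : iIndepFun X P) {c : ℕ → ℝ[X]}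
    (hφ : ∀ i, IsGaussDensity (hermiteExpansion (c i)))
    (hlaw : ∀ i, HasLaw (X i) (polyLaw (hermiteExpansion (c i))) P) {n : ℕ} (hn : 0 < n)
    (t : ℝ) : mgf id (P.map (renormSum X n)) t = Real.exp (t ^ 2 / 2)
      * ((∏ i ∈ Finset.range n, c i).comp (C (√(n : ℝ))⁻¹ * Polynomial.X)).eval t := by
  have hn' : (0 : ℝ) < n := by exact_mod_cast hn
  rw [mgf_map_renormSum hindep (fun i => (hlaw i).aemeasurable)]
  have h (i : ℕ) : mgf (X i) P (t / √(n : ℝ))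
      = Real.exp ((t / √(n : ℝ)) ^ 2 / 2) * (c i).eval (t / √(n : ℝ)) := by
    rw [← mgf_id_polyLaw_hermiteExpansion (hφ i), ← (hlaw i).map_eq,
      mgf_id_map (hlaw i).aemeasurable]
  simp_rw [h]
  rw [Finset.prod_mul_distrib, Finset.prod_const, Finset.card_range, ← Real.exp_nat_mul,
    eval_comp, eval_prod, div_pow, Real.sq_sqrt hn'.le]
  congr 2
  · field_simp
  · simp [div_eq_inv_mul]

/-- The `χ₂`-distance of the renormalized sum at time `n`, uniformly over the laws of the
summands. -/
theorem chiTwo_map_renormSum_le [IsProbabilityMeasure P]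
    (hindep : iIndepFun X P) {r : ℕ} (hr : 2 ≤ r) {c : ℕ → ℝ[X]}
    (hφ : ∀ i, IsGaussDensity (hermiteExpansion (c i)))
    (hm : ∀ i, MomentsMatch r (hermiteExpansion (c i)))
    (hH : ∀ i, HypH r (hermiteExpansion (c i)))
    (hlaw : ∀ i, HasLaw (X i) (polyLaw (hermiteExpansion (c i))) P) {A : ℝ} (hA0 : 0 ≤ A)
    (hA : ∀ i, ∀ t : ℝ, 0 ≤ t →
      (absCoeff (c i)).eval t - 1 ≤ A * t ^ (r + 1) * Real.exp (t ^ 2 / 4))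
    {n : ℕ} (hn : 0 < n) :
    chiTwo (P.map (renormSum X n)) stdGauss ≤ ENNReal.ofReal
      (n ^ 2 * A ^ 2 / (n : ℝ) ^ (r + 1) * ((r + 1).factorial * 2 ^ (r + 2))) ^ (1 / 2 : ℝ) := by
  have hn' : (0 : ℝ) < n := by exact_mod_cast hn
  have hprob := Measure.isProbabilityMeasure_map
    (aemeasurable_renormSum (fun i => (hlaw i).aemeasurable) n)
  rw [chiTwo_stdGauss_of_mgf (integrable_exp_mul_map_renormSum hindep hlaw n) _
    (mgf_map_renormSum_eq hindep hφ hlaw hn)]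
  set Q := ∏ i ∈ Finset.range n, c i with hQ
  set B := ∏ i ∈ Finset.range n, absCoeff (c i) with hB
  set D := Q.comp (C (√(n : ℝ))⁻¹ * Polynomial.X) with hD
  have hc0 (i : ℕ) : (c i).coeff 0 = 1 := (coeff_eq_of_momentsMatch (hφ i) (hm i)).1
  have hDk (k : ℕ) : D.coeff k = Q.coeff k * (√(n : ℝ))⁻¹ ^ k := comp_C_mul_X_coeff
  have hQB (k : ℕ) : |Q.coeff k| ≤ B.coeff k := abs_coeff_prod_le _ _ _
  have hQ0 : Q.coeff 0 = 1 := by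
    rw [coeff_zero_eq_eval_zero, hQ, eval_prod]
    exact Finset.prod_eq_one fun i _ => by rw [← coeff_zero_eq_eval_zero, hc0]
  have hB0 : B.coeff 0 = 1 := by
    rw [coeff_zero_eq_eval_zero, hB, eval_prod]
    exact Finset.prod_eq_one fun i _ => by
      rw [← coeff_zero_eq_eval_zero, coeff_absCoeff, hc0, abs_one]
  gcongr
  have hBn (k : ℕ) : 0 ≤ B.coeff k := (abs_nonneg _).trans (hQB k)
  refine le_trans ?_ (sum_factorial_mul_sq_le hBn hB0 n (A := A) (K := r + 1) ?_ hn)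
  · have hD1 (k : ℕ) (hk : k ≠ 0) : (D - 1).coeff k = Q.coeff k * (√(n : ℝ))⁻¹ ^ k := by
      rw [coeff_sub, coeff_one, if_neg hk, sub_zero, hDk]
    -- `D` has constant term 1, so only indices `k ≥ 1` contribute; there `D_k² ≤ B_k² / n^k`.
    have hk0 : ∀ k ∈ (D - 1).support, k ≠ 0 := by
      rintro k hk rfl
      rw [mem_support_iff] at hk
      simp [hDk, hQ0] at hk
    refine le_trans (Finset.sum_le_sum fun k hk => ?_)
      (Finset.sum_le_sum_of_subset_of_nonneg (fun k hk => ?_) fun k _ _ => ?_)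
    · rw [hD1 k (hk0 k hk), mul_pow, ← pow_mul, mul_comm k 2, pow_mul, inv_pow,
        Real.sq_sqrt hn'.le, inv_pow, ← div_eq_mul_inv]
      have h2 := pow_le_pow_left₀ (abs_nonneg _) (hQB k) 2
      rw [sq_abs] at h2
      exact mul_le_mul_of_nonneg_left (div_le_div_of_nonneg_right h2 (by positivity))
        (by positivity)
    · have h0 := hk0 k hk
      rw [mem_support_iff, hD1 k h0] at hk
      have hQk : 0 < |Q.coeff k| := abs_pos.2 (left_ne_zero_of_mul hk)
      have := le_natDegree_of_ne_zero (hQk.trans_le (hQB k)).ne'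
      rw [Finset.mem_Ico]; omega
    · have := hBn k
      positivity
  · intro t ht
    rw [hB, eval_prod]
    refine (prod_sub_one_le n _ (e := Real.exp (t ^ 2 / 4)) (a := A * t ^ (r + 1))
      (by positivity) (Real.one_le_exp (by positivity))
      (fun i _ => one_le_eval_absCoeff (hc0 i) ht)
      (fun i _ => eval_absCoeff_le_exp hr (hφ i) (hm i) (hH i) ht)
      (fun i _ => hA i t ht)).trans_eq ?_
    rw [← Real.exp_nat_mul, mul_div_assoc]; ring

theorem limsup_chiTwo_map_renormSum_lt_top [IsProbabilityMeasure P]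
    (hindep : iIndepFun X P) {r : ℕ} (hr : 2 ≤ r)
    (S : Finset ℝ[X]) (hS : ∀ φ ∈ S, IsGaussDensity φ ∧ MomentsMatch r φ ∧ HypH r φ)
    (hlaw : ∀ i, ∃ φ ∈ S, HasLaw (X i) (polyLaw φ) P) :
    (∀ n : ℕ, 1 ≤ n → P.map (renormSum X n) ≪ stdGauss) ∧
    limsup (fun n : ℕ => (n : ℝ≥0∞) ^ (((r : ℝ) - 1) / 2)
      * chiTwo (P.map (renormSum X n)) stdGauss) atTop < ∞ := by
  choose φ hφS hlaw using hlaw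
  obtain ⟨E, hE⟩ := hermiteExpansion_surjective.hasRightInverse
  have hEA : ∀ φ ∈ S, ∃ A : ℝ, 0 ≤ A ∧ ∀ t : ℝ, 0 ≤ t →
      (absCoeff (E φ)).eval t - 1 ≤ A * t ^ (r + 1) * Real.exp (t ^ 2 / 4) := fun φ hφ => by
    have h := hS φ hφ
    rw [← hE φ] at h
    exact exists_eval_absCoeff_sub_one_le hr h.1 h.2.1 h.2.2
  choose! a ha0 ha using hEA
  have hφ' (i : ℕ) : hermiteExpansion (E (φ i)) = φ i := hE _
  have hlaw' (i : ℕ) : HasLaw (X i) (polyLaw (hermiteExpansion (E (φ i)))) P := by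
    rw [hφ']; exact hlaw i
  have hG (i : ℕ) : IsGaussDensity (hermiteExpansion (E (φ i))) := by
    rw [hφ']; exact (hS _ (hφS i)).1
  constructor
  · intro n hn
    have hprob := Measure.isProbabilityMeasure_map
      (aemeasurable_renormSum (fun i => (hlaw i).aemeasurable) n)
    exact (eq_withDensity_hermiteExpansion_of_mgf
      (integrable_exp_mul_map_renormSum hindep hlaw n) _
      (mgf_map_renormSum_eq hindep hG hlaw' hn)).1
  -- Finiteness of `S` gives one constant for all summands, namely the sum of the nonnegative
  -- individual ones.
  set A := ∑ ψ ∈ S, a ψ with hAdef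
  have hbound (n : ℕ) (hn : 1 ≤ n) : (n : ℝ≥0∞) ^ (((r : ℝ) - 1) / 2)
      * chiTwo (P.map (renormSum X n)) stdGauss
      ≤ ENNReal.ofReal (A ^ 2 * ((r + 1).factorial * 2 ^ (r + 2))) ^ (1 / 2 : ℝ) := by
    have hn' : (0 : ℝ) < n := by exact_mod_cast hn
    have h := chiTwo_map_renormSum_le hindep hr (c := fun i => E (φ i)) hG
      (fun i => by rw [hφ']; exact (hS _ (hφS i)).2.1)
      (fun i => by rw [hφ']; exact (hS _ (hφS i)).2.2) hlaw'
      (A := A) (Finset.sum_nonneg ha0)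
      (fun i t ht => (ha _ (hφS i) t ht).trans (by
        gcongr
        exact Finset.single_le_sum ha0 (hφS i))) (n := n) (by omega)
    have hpow : (n : ℝ≥0∞) ^ (((r : ℝ) - 1) / 2)
        = ENNReal.ofReal ((n : ℝ) ^ (r - 1)) ^ (1 / 2 : ℝ) := by
      rw [ENNReal.ofReal_pow hn'.le, ENNReal.ofReal_natCast, ← ENNReal.rpow_natCast,
        ← ENNReal.rpow_mul, Nat.cast_sub (by omega)]
      congr 1; push_cast; ring
    refine (mul_le_mul_right h _).trans_eq ?_
    rw [hpow, ← ENNReal.mul_rpow_of_nonneg _ _ (by norm_num),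
      ← ENNReal.ofReal_mul (by positivity)]
    -- The powers of `n` cancel exactly: `n^(r-1) · n² / n^(r+1) = 1`.
    congr 2
    obtain ⟨m, rfl⟩ : ∃ m, r = m + 1 := ⟨r - 1, by omega⟩
    simp only [Nat.add_sub_cancel]
    field_simp
    ring
  refine (limsup_le_of_le (h := eventually_atTop.2 ⟨1, hbound⟩)).trans_lt ?_
  exact ENNReal.rpow_lt_top_of_nonneg (by norm_num) ENNReal.ofReal_ne_top

end Sums

theorem theorem1 {Ω : Type*} [MeasurableSpace Ω] (P : Measure Ω) [IsProbabilityMeasure P]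
    (X : ℕ → Ω → ℝ) (hindep : iIndepFun X P) (r : ℕ) (hr : 2 ≤ r) :
    -- the i.i.d. case
    (∀ φ : Polynomial ℝ, IsGaussDensity φ → MomentsMatch r φ → HypH r φ →
      (∀ i, HasLaw (X i) (polyLaw φ) P) →
      (∀ n : ℕ, 1 ≤ n → P.map (renormSum X n) ≪ stdGauss) ∧
      limsup (fun n : ℕ => (n : ℝ≥0∞) ^ (((r : ℝ) - 1) / 2)
        * chiTwo (P.map (renormSum X n)) stdGauss) atTop < ∞) ∧
    -- independent variables with finitely many possible distributions
    (∀ S : Finset (Polynomial ℝ),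
      (∀ φ ∈ S, IsGaussDensity φ ∧ MomentsMatch r φ ∧ HypH r φ) →
      (∀ i, ∃ φ ∈ S, HasLaw (X i) (polyLaw φ) P) →
      (∀ n : ℕ, 1 ≤ n → P.map (renormSum X n) ≪ stdGauss) ∧
      limsup (fun n : ℕ => (n : ℝ≥0∞) ^ (((r : ℝ) - 1) / 2)
        * chiTwo (P.map (renormSum X n)) stdGauss) atTop < ∞) := by
  refine ⟨fun φ h1 h2 h3 hlaw => ?_, fun S hS hlaw =>
    limsup_chiTwo_map_renormSum_lt_top hindep hr S hS hlaw⟩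
  exact limsup_chiTwo_map_renormSum_lt_top hindep hr {φ}
    (fun ψ hψ => by rw [Finset.mem_singleton.1 hψ]; exact ⟨h1, h2, h3⟩)
    (fun i => ⟨φ, Finset.mem_singleton_self φ, hlaw i⟩)
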